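/- Let $n \ge 2$ be an integer. An $n$-tuple $A=(A_1,\dots,A_n)$ of bounded operators on a complex Hilbert space $\mathcal H$ is a contraction if $\sum_i A_iA_i^*\le I$. Put $\Phi_A(X)=\sum_{i=1}^n A_iXA_i^*$. The contraction $A$ is pure if $\Phi_A^k(I)\to 0$ in the strong operator topology. The minimal isometric dilation of $A$ is the $n$-tuple $S=(S_1,\dots,S_n)$, unique up to unitary equivalence, of isometries with pairwise orthogonal ranges on a Hilbert space $\mathcal K\supseteq\mathcal H$ such that $S_i^*\mathcal H\subseteq\mathcal H$, $A_i=P_{\mathcal H}S_i|_{\mathcal H}$, and the vectors $S_{i_1}\cdots S_{i_d}x$ ($d\ge 0$, $x\in\mathcal H$) span a dense subspace of $\mathcal K$. The pure rank of $A$ is $\operatorname{rank}\bigl(I-\sum_i S_iS_i^*\bigr)$. The curvature invariant of $A$ is $$K(A)=(n-1)\lim_{k\to\infty}\frac{\operatorname{tr}(I-\Phi_A^k(I))}{n^k}\in[0,\infty].$$ Let $\mathcal F_n$ be the free unital semigroup on $n$ generators. Let $L_1,\dots,L_n$ be the isometries of $\mathcal H_n=\ell^2(\mathcal F_n)$ with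 $L_i\xi_w=\xi_{iw}$ for the standard basis vectors $\xi_w$, $w\in\mathcal F_n$. Let $L^{(\alpha)}=(L_1^{(\alpha)},\dots,L_n^{(\alpha)})$ be the direct sum of $\alpha$ copies of $L=(L_1,\dots,L_n)$, acting on $\mathcal H_n^{(\alpha)}$. Theorem. Let $\alpha<\infty$ be a non-negative integer, and let $A$ and $A_l$ ($l\ge1$) be pure contractive $n$-tuples of pure rank at most $\alpha$; they may act on the same space or on different ones. The limits that define $K(A)$ and all $K(A_l)$ exist. Each of these tuples is unitarily equivalent to the compression of $L^{(\alpha)}$ to a closed subspace of $\mathcal H_n^{(\alpha)}$ that is invariant under all $(L_i^{(\alpha)})^*$. Let $P_A$ and $P_{A_l}$ be the orthogonal projections of $\mathcal H_n^{(\alpha)}$ onto any such subspaces for $A$ and $A_l$. If $P_{A_l}\to P_A$ in the weak operator topology as $l\to\infty$, then $$\limsup_{l\to\infty}K(A_l)\le K(A).$$ -/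

import Mathlib

open Filter Topology
open scoped ENNReal InnerProductSpace

universe u v

noncomputable section

namespace RowContraction

/-! ### The trace of a positive operator -/

section Trace

variable {E : Type*} [NormedAddCommGroup E] [InnerProductSpace ℂ E]

/-- Parseval's identity. -/
theorem tsum_enorm_inner {ι : Type*} (b : HilbertBasis ι ℂ E) (x : E) :
    ∑' i, ENNReal.ofReal (‖⟪b i, x⟫_ℂ‖ ^ 2) = ENNReal.ofReal (‖x‖ ^ 2) := by
  have h := b.hasSum_inner_mul_inner x x
  have h2 : HasSum (fun i => ‖⟪b i, x⟫_ℂ‖ ^ 2) (‖x‖ ^ 2) := by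
    have h3 := Complex.reCLM.hasSum h
    convert h3 using 1
    · funext i
      simp only [Complex.reCLM_apply]
      rw [← inner_conj_symm x (b i), RCLike.conj_mul]
      norm_cast
    · simp only [Complex.reCLM_apply]
      rw [inner_self_eq_norm_sq_to_K]
      norm_cast
  rw [← ENNReal.ofReal_tsum_of_nonneg (fun i => by positivity) h2.summable, h2.tsum_eq]

variable [CompleteSpace E]

/-- The trace, with values in `[0, ∞]`, of a positive operator `T` on a Hilbert space: the sum
`∑ ⟪e i, T (e i)⟫` over an orthonormal basis `e`. -/
def posTrace (T : E →L[ℂ] E) : ℝ≥0∞ :=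
  ∑' e : (exists_hilbertBasis ℂ E).choose, ENNReal.ofReal (RCLike.re ⟪(e : E), T e⟫_ℂ)

/-- The sum defining the trace of a positive operator does not depend on the basis. -/
theorem tsum_inner_basis_indep {ι κ : Type*} (b : HilbertBasis ι ℂ E) (c : HilbertBasis κ ℂ E)
    {T : E →L[ℂ] E} (hT : 0 ≤ T) :
    ∑' i, ENNReal.ofReal (RCLike.re ⟪b i, T (b i)⟫_ℂ) =
      ∑' j, ENNReal.ofReal (RCLike.re ⟪c j, T (c j)⟫_ℂ) := by
  set S := CFC.sqrt T with hS
  have hSS : S * S = T := CFC.sqrt_mul_sqrt_self T hT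
  have hSa : ∀ x y : E, ⟪S x, y⟫_ℂ = ⟪x, S y⟫_ℂ :=
    ((ContinuousLinearMap.nonneg_iff_isPositive S).1 (CFC.sqrt_nonneg T)).isSymmetric
  have key : ∀ x : E, RCLike.re ⟪x, T x⟫_ℂ = ‖S x‖ ^ 2 := by
    intro x
    rw [← hSS]
    change RCLike.re ⟪x, S (S x)⟫_ℂ = _
    rw [← hSa]
    exact inner_self_eq_norm_sq (S x)
  simp only [key]
  calc ∑' i, ENNReal.ofReal (‖S (b i)‖ ^ 2)
      = ∑' i, ∑' j, ENNReal.ofReal (‖⟪c j, S (b i)⟫_ℂ‖ ^ 2) := by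
        simp only [tsum_enorm_inner c]
    _ = ∑' j, ∑' i, ENNReal.ofReal (‖⟪c j, S (b i)⟫_ℂ‖ ^ 2) := ENNReal.tsum_comm
    _ = ∑' j, ∑' i, ENNReal.ofReal (‖⟪b i, S (c j)⟫_ℂ‖ ^ 2) := by
        simp only [← hSa, norm_inner_symm]
    _ = ∑' j, ENNReal.ofReal (‖S (c j)‖ ^ 2) := by
        simp only [tsum_enorm_inner b]

/-- The trace of a positive operator may be computed in any orthonormal basis. -/
theorem posTrace_eq {ι : Type*} (b : HilbertBasis ι ℂ E) {T : E →L[ℂ] E} (hT : 0 ≤ T) :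
    posTrace T = ∑' i, ENNReal.ofReal (RCLike.re ⟪b i, T (b i)⟫_ℂ) := by
  obtain ⟨c, hc⟩ := (exists_hilbertBasis ℂ E).choose_spec
  rw [← tsum_inner_basis_indep c b hT]
  simp only [posTrace, hc]

end Trace

/-! ### Row contractions and their invariants -/

section Tuples

variable {n : ℕ} {E : Type u} [NormedAddCommGroup E] [InnerProductSpace ℂ E] [CompleteSpace E]

/-- The completely positive map `Φ_A(X) = ∑ i, A i * X * (A i)^*`. -/
def cpMap (A : Fin n → E →L[ℂ] E) (X : E →L[ℂ] E) : E →L[ℂ] E :=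
  ∑ i, A i ∘L X ∘L ContinuousLinearMap.adjoint (A i)

/-- The operator `Φ_A^k(I)`. -/
def cpPow (A : Fin n → E →L[ℂ] E) (k : ℕ) : E →L[ℂ] E :=
  (cpMap A)^[k] 1

/-- The tuple `A` is a row contraction: `∑ i, A i * (A i)^* ≤ I`. -/
def IsContractive (A : Fin n → E →L[ℂ] E) : Prop :=
  ∑ i, A i ∘L ContinuousLinearMap.adjoint (A i) ≤ 1

/-- The tuple `A` is a pure contraction: a row contraction with `Φ_A^k(I) → 0` strongly. -/
def IsPureContraction (A : Fin n → E →L[ℂ] E) : Prop :=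
  IsContractive A ∧ ∀ x, Tendsto (fun k => cpPow A k x) atTop (𝓝 0)

/-- The normalized trace `tr (I - Φ_A^k(I)) / n^k`. -/
def normTrace (A : Fin n → E →L[ℂ] E) (k : ℕ) : ℝ≥0∞ :=
  posTrace (1 - cpPow A k) / (n : ℝ≥0∞) ^ k

/-- The curvature invariant `K(A) = (n - 1) * lim_k tr (I - Φ_A^k(I)) / n^k`. -/
def curvature (A : Fin n → E →L[ℂ] E) : ℝ≥0∞ :=
  ((n : ℝ≥0∞) - 1) * limUnder atTop (normTrace A)

/-- `S`, acting on a Hilbert space `K` into which `E` is isometrically embedded by `V`, is a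
minimal isometric dilation of `A`: the `S i` are isometries with pairwise orthogonal ranges, `E` is
co-invariant, each `A i` is the compression of `S i` to `E`, and the vectors `S_w x`, for words
`w` and `x` in `E`, span a dense subspace of `K`. -/
structure IsMinimalIsometricDilation {K : Type*} [NormedAddCommGroup K] [InnerProductSpace ℂ K]
    [CompleteSpace K] (A : Fin n → E →L[ℂ] E) (V : E →ₗᵢ[ℂ] K) (S : Fin n → K →L[ℂ] K) : Prop where
  isometry : ∀ i j, ContinuousLinearMap.adjoint (S i) ∘L S j = if i = j then 1 else 0
  coinvariant : ∀ i x, ContinuousLinearMap.adjoint (S i) (V x) ∈ Set.range V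
  compression : ∀ i x,
    ContinuousLinearMap.adjoint V.toContinuousLinearMap (S i (V x)) = A i x
  minimal : (Submodule.span ℂ
    {y : K | ∃ (w : List (Fin n)) (x : E), y = (w.map S).prod (V x)}).topologicalClosure = ⊤

/-- The rank of an operator, with infinite ranks identified. -/
def opRank {K : Type*} [NormedAddCommGroup K] [InnerProductSpace ℂ K] (T : K →L[ℂ] K) : ℕ∞ :=
  Cardinal.toENat (LinearMap.rank (T : K →ₗ[ℂ] K))

/-- The pure rank of `A`: the rank of `I - ∑ i, S i * (S i)^*` for the minimal isometric
dilation `S` of `A`. The minimal isometric dilation exists and is unique up to unitary equivalence,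
so the infimum is taken over a single value. -/
def pureRank (A : Fin n → E →L[ℂ] E) : ℕ∞ :=
  sInf {r : ℕ∞ | ∃ (K : Type u) (_ : NormedAddCommGroup K) (_ : InnerProductSpace ℂ K)
    (_ : CompleteSpace K) (V : E →ₗᵢ[ℂ] K) (S : Fin n → K →L[ℂ] K),
    IsMinimalIsometricDilation A V S ∧
      r = opRank (1 - ∑ i, S i ∘L ContinuousLinearMap.adjoint (S i))}

end Tuples

/-! ### The left regular representation on Fock space -/

/-- The Fock space `ℓ²(𝓕_n)`, where `𝓕_n` is the free unital semigroup on `n` generators. -/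
abbrev Fock (n : ℕ) : Type := lp (fun _ : FreeMonoid (Fin n) => ℂ) 2

open scoped Classical in
/-- The basis vector `ξ_w` of Fock space. -/
def xi {n : ℕ} (w : FreeMonoid (Fin n)) : Fock n := lp.single 2 w 1

theorem orthonormal_xi (n : ℕ) : Orthonormal ℂ (xi : FreeMonoid (Fin n) → Fock n) := by
  classical
  rw [orthonormal_iff_ite]
  intro v w
  simp only [xi]
  rw [lp.inner_single_left, lp.single_apply]
  by_cases h : v = w
  · subst h; simp
  · simp [h]

theorem orthonormal_xi_mul (n : ℕ) (i : Fin n) :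
    Orthonormal ℂ (fun w : FreeMonoid (Fin n) => xi (FreeMonoid.of i * w)) :=
  (orthonormal_xi n).comp _ (mul_right_injective _)

/-- The left creation operator `L_i`, the isometry with `L_i ξ_w = ξ_{iw}`. -/
def leftCreation {n : ℕ} (i : Fin n) : Fock n →L[ℂ] Fock n :=
  (orthonormal_xi_mul n i).orthogonalFamily.linearIsometry.toContinuousLinearMap

theorem leftCreation_xi {n : ℕ} (i : Fin n) (w : FreeMonoid (Fin n)) :
    leftCreation i (xi w) = xi (FreeMonoid.of i * w) := by
  classical
  simp [leftCreation, xi]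

/-- The direct sum of `α` copies of Fock space. -/
abbrev FockSum (n α : ℕ) : Type := PiLp 2 (fun _ : Fin α => Fock n)

/-- The operator `L_i^{(α)}`, the direct sum of `α` copies of `L_i`. -/
def leftCreationSum {n : ℕ} (α : ℕ) (i : Fin n) : FockSum n α →L[ℂ] FockSum n α :=
  (PiLp.continuousLinearEquiv 2 ℂ (fun _ : Fin α => Fock n)).symm.toContinuousLinearMap ∘L
    ContinuousLinearMap.pi (fun j => leftCreation i ∘L PiLp.proj 2 (fun _ : Fin α => Fock n) j)

theorem leftCreationSum_apply {n : ℕ} (α : ℕ) (i : Fin n) (f : FockSum n α) (j : Fin α) :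
    leftCreationSum α i f j = leftCreation i (f j) := rfl

/-- `P` is the orthogonal projection onto a subspace of the direct sum of `α` copies of Fock space
which is co-invariant for `L^{(α)}` and such that `A` is, up to a unitary identification `U` of the
space on which `A` acts with this subspace, the compression of `L^{(α)}` to it. -/
def IsDeterminingProjection {n : ℕ} {E : Type*} [NormedAddCommGroup E] [InnerProductSpace ℂ E]
    (A : Fin n → E →L[ℂ] E) (α : ℕ) (P : FockSum n α →L[ℂ] FockSum n α) : Prop :=
  IsStarProjection P ∧
  (∀ i, ∀ f ∈ Set.range P,
    ContinuousLinearMap.adjoint (leftCreationSum α i) f ∈ Set.range P) ∧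
  ∃ U : E →ₗᵢ[ℂ] FockSum n α, Set.range U = Set.range P ∧
    ∀ i x, U (A i x) = P (leftCreationSum α i (U x))

end RowContraction

end

open RowContraction

/-! Let `P` be a determining projection of `A`, and let t_m (`levelMass P m`) be the trace of its
compression to the words of length m. Co-invariance means P L_i = P L_i P, so ‖P L_i f‖ ≤ ‖P f‖,
t_{m+1} ≤ n t_m, and t_m / n^m decreases (`antitone_level`). If U identifies the space of `A` with
the range of `P`, then I - Φ_A^k(I) = U^* E_k U, where E_k projects onto the words of length less
than k; hence tr(I - Φ_A^k(I)) = t_0 + ... + t_{k-1} (`posTrace_one_sub_cpPow`). A weighted Cesàro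
argument gives K(A) = inf_m t_m / n^m (`curvature_eq`).

Each t_m is a finite sum of matrix coefficients of `P`, so it is continuous in the weak operator
topology, and an infimum of continuous functions is upper semicontinuous (`limsup_curvature_le`).

A projection exists because the defect of `A` factors through ℂ^α by functionals β_j, and x ↦
(β_j(A_w^* x))_{j,w} is an isometry intertwining A_i^* with L_i^* (`exists_poisson`); purity gives
the isometry. -/

noncomputable section

namespace RowContraction

open ContinuousLinearMap (adjoint)

/-! ### Words of a given length -/

section Words

variable {n : ℕ}

open scoped Classical in
/-- The finite set of words of length `k` in `n` letters. -/
def sphere (n : ℕ) : ℕ → Finset (FreeMonoid (Fin n))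
  | 0 => {1}
  | k + 1 => Finset.univ.biUnion fun i => (sphere n k).image (FreeMonoid.of i * ·)

theorem mem_sphere (k : ℕ) (w : FreeMonoid (Fin n)) : w ∈ sphere n k ↔ w.length = k := by
  classical
  induction k generalizing w with
  | zero => simp [sphere, FreeMonoid.length_eq_zero]
  | succ k ih =>
    simp only [sphere, Finset.mem_biUnion, Finset.mem_univ, true_and, Finset.mem_image, ih]
    constructor
    · rintro ⟨i, v, hv, rfl⟩
      simp [FreeMonoid.length_mul, hv, add_comm]
    · intro h
      induction w using FreeMonoid.casesOn with
      | one => simp at h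
      | of_mul i v =>
        exact ⟨i, v, by simpa [FreeMonoid.length_mul, add_comm] using h, rfl⟩

theorem of_mul_inj {i j : Fin n} {v w : FreeMonoid (Fin n)}
    (h : FreeMonoid.of i * v = FreeMonoid.of j * w) : i = j ∧ v = w :=
  List.cons_eq_cons.1 h

theorem sum_sphere_zero {M : Type*} [AddCommMonoid M] (g : FreeMonoid (Fin n) → M) :
    ∑ w ∈ sphere n 0, g w = g 1 := by
  simp [sphere]

theorem sum_sphere_succ {M : Type*} [AddCommMonoid M] (k : ℕ) (g : FreeMonoid (Fin n) → M) :
    ∑ w ∈ sphere n (k + 1), g w = ∑ i, ∑ w ∈ sphere n k, g (FreeMonoid.of i * w) := by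
  classical
  rw [sphere, Finset.sum_biUnion]
  · refine Finset.sum_congr rfl fun i _ => ?_
    rw [Finset.sum_image fun v _ w _ h => (of_mul_inj h).2]
  · intro i _ j _ hij
    rw [Function.onFun, Finset.disjoint_left]
    rintro _ hv hw
    obtain ⟨v, -, rfl⟩ := Finset.mem_image.1 hv
    obtain ⟨w, -, h⟩ := Finset.mem_image.1 hw
    exact hij (of_mul_inj h).1.symm

/-- The finite set of words of length less than `k` in `n` letters. -/
def ball (n k : ℕ) : Finset (FreeMonoid (Fin n)) :=
  (Finset.range k).disjiUnion (sphere n) (by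
    intro i _ j _ hij
    rw [Function.onFun, Finset.disjoint_left]
    intro w hi hj
    exact hij (((mem_sphere i w).1 hi).symm.trans ((mem_sphere j w).1 hj)))

theorem mem_ball (k : ℕ) (w : FreeMonoid (Fin n)) : w ∈ ball n k ↔ w.length < k := by
  rw [ball]
  refine Finset.mem_disjiUnion.trans ?_
  simp [mem_sphere]

theorem sum_ball {M : Type*} [AddCommMonoid M] (k : ℕ) (g : FreeMonoid (Fin n) → M) :
    ∑ w ∈ ball n k, g w = ∑ m ∈ Finset.range k, ∑ w ∈ sphere n m, g w :=
  Finset.sum_disjiUnion _ _ _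

theorem sum_ball_succ {M : Type*} [AddCommMonoid M] (k : ℕ) (g : FreeMonoid (Fin n) → M) :
    ∑ w ∈ ball n (k + 1), g w = (∑ i, ∑ w ∈ ball n k, g (FreeMonoid.of i * w)) + g 1 := by
  simp only [sum_ball, Finset.sum_range_succ', sum_sphere_succ, sum_sphere_zero]
  rw [Finset.sum_comm]

theorem tendsto_ball (n : ℕ) : Tendsto (ball n) atTop atTop := by
  refine tendsto_atTop_finset_of_monotone (fun k l h w => ?_) fun w => ⟨w.length + 1, ?_⟩
  · rw [mem_ball, mem_ball]
    exact fun hw => hw.trans_le h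
  · rw [mem_ball]
    exact Nat.lt_succ_self _

/-- A sum over all words, split according to the first letter. -/
theorem tsum_words {g : FreeMonoid (Fin n) → ℝ} (hg : Summable g) :
    ∑' w, g w = (∑ i, ∑' w, g (FreeMonoid.of i * w)) + g 1 := by
  -- Radii k + 1 match the recursion `sum_ball_succ`, which leaves radius k after the first letter
  -- is removed.
  have h1 := (hg.hasSum.comp (tendsto_ball n)).comp (tendsto_add_atTop_nat 1)
  refine tendsto_nhds_unique h1 ?_
  simp only [Function.comp_def, sum_ball_succ]
  refine Tendsto.add_const _ (tendsto_finsetSum _ fun i _ => ?_)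
  exact (hg.comp_injective (mul_right_injective (FreeMonoid.of i))).hasSum.comp (tendsto_ball n)

end Words

/-! ### Coordinates on Fock space -/

section FockSpace

variable {n α : ℕ}

theorem inner_xi (w : FreeMonoid (Fin n)) (f : Fock n) : ⟪xi w, f⟫_ℂ = f w := by
  classical
  rw [xi, lp.inner_single_left]
  simp

theorem adjoint_leftCreation_apply (i : Fin n) (f : Fock n) (w : FreeMonoid (Fin n)) :
    adjoint (leftCreation i) f w = f (FreeMonoid.of i * w) := by
  rw [← inner_xi, ContinuousLinearMap.adjoint_inner_right, leftCreation_xi, inner_xi]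

theorem hasSum_norm_sq (f : Fock n) : HasSum (fun w => ‖f w‖ ^ 2) (‖f‖ ^ 2) := by
  have h := lp.hasSum_norm (p := 2) (by norm_num) f
  simpa using h

theorem adjoint_leftCreationSum_apply (i : Fin n) (f : FockSum n α) (j : Fin α) :
    adjoint (leftCreationSum α i) f j = adjoint (leftCreation i) (f j) := by
  let g : FockSum n α := WithLp.toLp 2 fun j => adjoint (leftCreation i) (f j)
  have h : adjoint (leftCreationSum α i) f = g := by
    refine ext_inner_left ℂ fun x => ?_
    rw [ContinuousLinearMap.adjoint_inner_right, PiLp.inner_apply, PiLp.inner_apply]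
    refine Finset.sum_congr rfl fun j _ => ?_
    rw [leftCreationSum_apply]
    exact (ContinuousLinearMap.adjoint_inner_right _ _ _).symm
  rw [h]

theorem norm_leftCreationSum_apply (i : Fin n) (f : FockSum n α) :
    ‖leftCreationSum α i f‖ = ‖f‖ := by
  rw [PiLp.norm_eq_of_L2, PiLp.norm_eq_of_L2]
  congr 1
  refine Finset.sum_congr rfl fun j _ => ?_
  rw [leftCreationSum_apply]
  congr 1
  exact LinearIsometry.norm_map _ _

/-- The basis vector `ξ_w` in the `j`-th copy of Fock space. -/
def xiSum (j : Fin α) (w : FreeMonoid (Fin n)) : FockSum n α :=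
  PiLp.single 2 j (xi w)

theorem inner_xiSum (j : Fin α) (w : FreeMonoid (Fin n)) (f : FockSum n α) :
    ⟪xiSum j w, f⟫_ℂ = f j w := by
  rw [PiLp.inner_apply, Finset.sum_eq_single j]
  · simp [xiSum, inner_xi]
  · intro i _ hij
    simp [xiSum, hij]
  · simp

theorem leftCreationSum_xiSum (i : Fin n) (j : Fin α) (w : FreeMonoid (Fin n)) :
    leftCreationSum α i (xiSum j w) = xiSum j (FreeMonoid.of i * w) := by
  refine ext_inner_right ℂ fun f => ?_
  rw [← ContinuousLinearMap.adjoint_inner_right, inner_xiSum, inner_xiSum,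
    adjoint_leftCreationSum_apply, adjoint_leftCreation_apply]

/-- `I - ∑ L_i L_i^*` is the projection onto the vacuum vectors. -/
theorem sum_norm_vacuum (f : FockSum n α) :
    ∑ j, ‖f j 1‖ ^ 2 = ‖f‖ ^ 2 - ∑ i, ‖adjoint (leftCreationSum α i) f‖ ^ 2 := by
  simp only [PiLp.norm_sq_eq_of_L2, adjoint_leftCreationSum_apply]
  rw [Finset.sum_comm, ← Finset.sum_sub_distrib]
  refine Finset.sum_congr rfl fun j _ => ?_
  simp only [← fun f : Fock n => (hasSum_norm_sq f).tsum_eq, adjoint_leftCreation_apply]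
  rw [tsum_words (hasSum_norm_sq (f j)).summable]
  ring

end FockSpace

/-! ### The iterates of the completely positive map -/

section Iterates

variable {n : ℕ} {E : Type*} [NormedAddCommGroup E] [InnerProductSpace ℂ E] [CompleteSpace E]

theorem adjoint_lift_of_mul (A : Fin n → E →L[ℂ] E) (i : Fin n) (w : FreeMonoid (Fin n)) (x : E) :
    adjoint (FreeMonoid.lift A (FreeMonoid.of i * w)) x =
      adjoint (FreeMonoid.lift A w) (adjoint (A i) x) := by
  rw [map_mul, FreeMonoid.lift_eval_of, ContinuousLinearMap.mul_def,
    ContinuousLinearMap.adjoint_comp]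
  rfl

theorem adjoint_lift_one (A : Fin n → E →L[ℂ] E) (x : E) :
    adjoint (FreeMonoid.lift A 1) x = x := by
  rw [map_one, ContinuousLinearMap.one_def, ContinuousLinearMap.adjoint_id]
  rfl

theorem re_inner_cpPow_zero (A : Fin n → E →L[ℂ] E) (x : E) :
    RCLike.re ⟪x, cpPow A 0 x⟫_ℂ = ‖x‖ ^ 2 :=
  inner_self_eq_norm_sq x

theorem re_inner_cpPow_succ (A : Fin n → E →L[ℂ] E) (k : ℕ) (x : E) :
    RCLike.re ⟪x, cpPow A (k + 1) x⟫_ℂ =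
      ∑ i, RCLike.re ⟪adjoint (A i) x, cpPow A k (adjoint (A i) x)⟫_ℂ := by
  rw [cpPow, Function.iterate_succ_apply', ← cpPow, cpMap]
  simp only [sum_apply, inner_sum, map_sum, ContinuousLinearMap.comp_apply,
    ContinuousLinearMap.adjoint_inner_left]

/-- Quadratic form of Φ^k(I - Φ(I)) = ∑_{|w|=k} A_w (I - ∑ A_i A_i^*) A_w^*; these differences
telescope to I - Φ^k(I). -/
theorem re_inner_cpPow_sub (A : Fin n → E →L[ℂ] E) (k : ℕ) (x : E) :
    RCLike.re ⟪x, cpPow A k x⟫_ℂ - RCLike.re ⟪x, cpPow A (k + 1) x⟫_ℂ =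
      ∑ w ∈ sphere n k, (‖adjoint (FreeMonoid.lift A w) x‖ ^ 2 -
        ∑ i, ‖adjoint (A i) (adjoint (FreeMonoid.lift A w) x)‖ ^ 2) := by
  induction k generalizing x with
  | zero =>
    simp only [sum_sphere_zero, adjoint_lift_one, re_inner_cpPow_zero, re_inner_cpPow_succ]
  | succ k ih =>
    rw [re_inner_cpPow_succ, re_inner_cpPow_succ A (k + 1), ← Finset.sum_sub_distrib,
      sum_sphere_succ]
    simp only [ih, adjoint_lift_of_mul]

/-- The quadratic form of `I - Φ_A^k(I)`, as a sum over words of length less than `k`. -/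
theorem re_inner_one_sub_cpPow (A : Fin n → E →L[ℂ] E) (k : ℕ) (x : E) :
    RCLike.re ⟪x, (1 - cpPow A k) x⟫_ℂ =
      ∑ w ∈ ball n k, (‖adjoint (FreeMonoid.lift A w) x‖ ^ 2 -
        ∑ i, ‖adjoint (A i) (adjoint (FreeMonoid.lift A w) x)‖ ^ 2) := by
  rw [sum_ball, Finset.sum_congr rfl fun m _ => (re_inner_cpPow_sub A m x).symm,
    Finset.sum_range_sub', re_inner_cpPow_zero, _root_.sub_apply, inner_sub_right,
    map_sub]
  congr 1
  exact inner_self_eq_norm_sq x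

end Iterates

/-! ### Determining projections -/

section Determining

variable {n α : ℕ} {E : Type*} [NormedAddCommGroup E] [InnerProductSpace ℂ E]

theorem star_projection_inner {P : FockSum n α →L[ℂ] FockSum n α} (hP : IsStarProjection P)
    (f g : FockSum n α) : ⟪P f, g⟫_ℂ = ⟪f, P g⟫_ℂ := by
  have h : adjoint P = P := hP.isSelfAdjoint
  rw [← ContinuousLinearMap.adjoint_inner_left, h]

theorem star_projection_apply_of_mem {P : FockSum n α →L[ℂ] FockSum n α} (hP : IsStarProjection P)
    {f : FockSum n α} (hf : f ∈ Set.range P) : P f = f := by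
  obtain ⟨g, rfl⟩ := hf
  exact DFunLike.congr_fun hP.isIdempotentElem g

theorem star_projection_norm_sq {P : FockSum n α →L[ℂ] FockSum n α} (hP : IsStarProjection P)
    (f : FockSum n α) : ‖P f‖ ^ 2 = RCLike.re ⟪f, P f⟫_ℂ := by
  rw [← star_projection_apply_of_mem hP ⟨f, rfl⟩, ← star_projection_inner hP,
    star_projection_apply_of_mem hP ⟨f, rfl⟩]
  exact (inner_self_eq_norm_sq _).symm

theorem star_projection_norm_le {P : FockSum n α →L[ℂ] FockSum n α} (hP : IsStarProjection P)
    (f : FockSum n α) : ‖P f‖ ≤ ‖f‖ := by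
  have h := star_projection_norm_sq hP f
  have h2 : RCLike.re ⟪f, P f⟫_ℂ ≤ ‖f‖ * ‖P f‖ := re_inner_le_norm f (P f)
  by_contra! hlt
  nlinarith [norm_nonneg f]

variable {A : Fin n → E →L[ℂ] E} {P : FockSum n α →L[ℂ] FockSum n α}

theorem IsDeterminingProjection.norm_apply_leftCreationSum_le (h : IsDeterminingProjection A α P)
    (i : Fin n) (f : FockSum n α) : ‖P (leftCreationSum α i f)‖ ≤ ‖P f‖ := by
  obtain ⟨hP, hL, -⟩ := h
  -- This is the adjoint of the statement that L_i^* preserves the range of `P`.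
  have key : P (leftCreationSum α i f) = P (leftCreationSum α i (P f)) := by
    refine ext_inner_left ℂ fun g => ?_
    rw [← star_projection_inner hP, ← star_projection_inner hP,
      ← ContinuousLinearMap.adjoint_inner_left, ← ContinuousLinearMap.adjoint_inner_left,
      ← star_projection_inner hP, star_projection_apply_of_mem hP (hL i _ ⟨g, rfl⟩)]
  rw [key]
  exact (star_projection_norm_le hP _).trans_eq (norm_leftCreationSum_apply i _)

variable [CompleteSpace E]

/-- The unitary identification attached to a determining projection intertwines the adjoints. -/
theorem IsDeterminingProjection.exists_intertwiner (h : IsDeterminingProjection A α P) :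
    ∃ U : E →ₗᵢ[ℂ] FockSum n α,
      (∀ f, U (adjoint U.toContinuousLinearMap f) = P f) ∧
      ∀ i x, U (adjoint (A i) x) = adjoint (leftCreationSum α i) (U x) := by
  obtain ⟨hP, hL, U, hU, hA⟩ := h
  have hPU : ∀ x, P (U x) = U x := fun x =>
    star_projection_apply_of_mem hP (hU ▸ Set.mem_range_self x)
  refine ⟨U, fun f => ?_, fun i x => ?_⟩
  · obtain ⟨y, hy⟩ : P f ∈ Set.range U := hU ▸ Set.mem_range_self f
    rw [← hy]
    congr 1
    refine ext_inner_left ℂ fun x => ?_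
    rw [ContinuousLinearMap.adjoint_inner_right, ← U.inner_map_map, hy,
      ← star_projection_inner hP, hPU]
    rfl
  · obtain ⟨z, hz⟩ : adjoint (leftCreationSum α i) (U x) ∈ Set.range U :=
      hU ▸ hL i _ (hU ▸ Set.mem_range_self x)
    rw [← hz]
    congr 1
    refine ext_inner_left ℂ fun y => ?_
    rw [ContinuousLinearMap.adjoint_inner_right, ← U.inner_map_map, hA, star_projection_inner hP,
      hPU, ← U.inner_map_map, hz, ContinuousLinearMap.adjoint_inner_right]

/-- On Fock space L_w^* deletes the prefix w. With v = 1, the vacuum coordinates of U A_w^* x are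
the coordinates of U x at w. -/
theorem intertwiner_word {U : E →ₗᵢ[ℂ] FockSum n α}
    (hU : ∀ i x, U (adjoint (A i) x) = adjoint (leftCreationSum α i) (U x))
    (w : FreeMonoid (Fin n)) (x : E) (j : Fin α) (v : FreeMonoid (Fin n)) :
    U (adjoint (FreeMonoid.lift A w) x) j v = U x j (w * v) := by
  induction w using FreeMonoid.inductionOn' generalizing x with
  | one => rw [adjoint_lift_one, one_mul]
  | of_mul i w ih =>
    rw [adjoint_lift_of_mul, ih, hU, adjoint_leftCreationSum_apply, adjoint_leftCreation_apply,
      mul_assoc]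

end Determining

/-! ### Traces -/

section Curvature

variable {n α : ℕ}

/-- The trace of the compression of `P` to the span of the words of length `m`. -/
def levelMass (P : FockSum n α →L[ℂ] FockSum n α) (m : ℕ) : ℝ :=
  ∑ w ∈ sphere n m, ∑ j, ‖P (xiSum j w)‖ ^ 2

theorem levelMass_nonneg (P : FockSum n α →L[ℂ] FockSum n α) (m : ℕ) : 0 ≤ levelMass P m :=
  Finset.sum_nonneg fun _ _ => Finset.sum_nonneg fun _ _ => by positivity

variable {E : Type*} [NormedAddCommGroup E] [InnerProductSpace ℂ E]
  {A : Fin n → E →L[ℂ] E} {P : FockSum n α →L[ℂ] FockSum n α}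

theorem IsDeterminingProjection.levelMass_succ_le (h : IsDeterminingProjection A α P) (m : ℕ) :
    levelMass P (m + 1) ≤ n * levelMass P m := by
  rw [levelMass, sum_sphere_succ]
  refine (Finset.sum_le_card_nsmul _ _ (levelMass P m) fun i _ => ?_).trans_eq (by simp)
  refine Finset.sum_le_sum fun w _ => Finset.sum_le_sum fun j _ => ?_
  rw [← leftCreationSum_xiSum]
  gcongr
  exact h.norm_apply_leftCreationSum_le i _

theorem IsDeterminingProjection.antitone_level (h : IsDeterminingProjection A α P) (hn : 2 ≤ n) :
    Antitone fun m => levelMass P m / (n : ℝ) ^ m := by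
  have hn0 : (0 : ℝ) < n := by exact_mod_cast (by omega : 0 < n)
  refine antitone_nat_of_succ_le fun m => ?_
  rw [div_le_div_iff₀ (by positivity) (by positivity), pow_succ]
  nlinarith [mul_le_mul_of_nonneg_right (h.levelMass_succ_le m) (pow_pos hn0 m).le]

variable [CompleteSpace E]

/-- The defect form of `A` is the vacuum mass after applying U, so I - Φ^k(I) becomes a finite sum
of rank-one operators, one for each U^* ξ_{j,w} with |w| < k. -/
theorem re_inner_one_sub_cpPow_eq_sum {U : E →ₗᵢ[ℂ] FockSum n α}
    (hU : ∀ i x, U (adjoint (A i) x) = adjoint (leftCreationSum α i) (U x)) (k : ℕ) (x : E) :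
    RCLike.re ⟪x, (1 - cpPow A k) x⟫_ℂ =
      ∑ w ∈ ball n k, ∑ j, ‖⟪adjoint U.toContinuousLinearMap (xiSum j w), x⟫_ℂ‖ ^ 2 := by
  rw [re_inner_one_sub_cpPow]
  refine Finset.sum_congr rfl fun w _ => ?_
  simp only [← U.norm_map, hU, ← sum_norm_vacuum]
  refine Finset.sum_congr rfl fun j _ => ?_
  rw [intertwiner_word hU, mul_one, ContinuousLinearMap.adjoint_inner_left, ← inner_xiSum]
  rfl

/-- By Parseval each rank-one term has trace ‖U^* ξ_{j,w}‖² = ‖P ξ_{j,w}‖². -/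
theorem IsDeterminingProjection.posTrace_one_sub_cpPow (h : IsDeterminingProjection A α P)
    (k : ℕ) :
    posTrace (1 - cpPow A k) = ENNReal.ofReal (∑ m ∈ Finset.range k, levelMass P m) := by
  obtain ⟨U, hP, hU⟩ := h.exists_intertwiner
  -- This is the basis chosen in `posTrace`, so no change of basis is needed.
  obtain ⟨b, hb⟩ := (exists_hilbertBasis ℂ E).choose_spec
  rw [posTrace]
  simp only [← congrFun hb, re_inner_one_sub_cpPow_eq_sum hU]
  simp only [ENNReal.ofReal_sum_of_nonneg (fun _ _ => Finset.sum_nonneg fun _ _ => sq_nonneg _),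
    ENNReal.ofReal_sum_of_nonneg (fun _ _ => sq_nonneg _)]
  rw [ENNReal.ofReal_sum_of_nonneg (fun _ _ => levelMass_nonneg _ _),
    Summable.tsum_finsetSum (fun _ _ => ENNReal.summable), sum_ball]
  refine Finset.sum_congr rfl fun m _ => ?_
  rw [levelMass, ENNReal.ofReal_sum_of_nonneg
    (fun _ _ => Finset.sum_nonneg fun _ _ => sq_nonneg _)]
  refine Finset.sum_congr rfl fun w _ => ?_
  rw [Summable.tsum_finsetSum (fun _ _ => ENNReal.summable),
    ENNReal.ofReal_sum_of_nonneg (fun _ _ => sq_nonneg _)]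
  refine Finset.sum_congr rfl fun j _ => ?_
  rw [← hP, U.norm_map, ← tsum_enorm_inner b]
  refine tsum_congr fun i => ?_
  rw [norm_inner_symm]

/-- A weighted Cesàro limit. -/
theorem tendsto_geom_cesaro {r c : ℝ} (hr : 1 < r) {s : ℕ → ℝ}
    (hs : Tendsto (fun m => s m / r ^ m) atTop (𝓝 c)) :
    Tendsto (fun k => (∑ m ∈ Finset.range k, s m) / r ^ k) atTop (𝓝 (c / (r - 1))) := by
  have hr0 : 0 < r := by linarith
  have hgeom : ∀ k, ∑ m ∈ Finset.range k, r ^ m = (r ^ k - 1) / (r - 1) :=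
    fun k => geom_sum_eq hr.ne' k
  have hpow := tendsto_pow_atTop_atTop_of_one_lt hr
  -- Write s_m = c r^m + o(r^m): the main part sums to a geometric series, and the error sums to
  -- o(r^k) because ∑ r^m diverges.
  have h1 : (fun m => s m - c * r ^ m) =o[atTop] fun m => r ^ m := by
    rw [Asymptotics.isLittleO_iff_tendsto (fun m hm => absurd hm (by positivity))]
    have h2 := hs.sub_const c
    rw [sub_self] at h2
    refine h2.congr fun m => ?_
    field_simp
  have h2 := h1.sum_range (fun m => by positivity) (by
    simp only [hgeom]
    exact (tendsto_atTop_add_const_right _ _ hpow).atTop_div_const (by linarith))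
  have h3 : (fun k => ∑ m ∈ Finset.range k, r ^ m) =O[atTop] fun k => r ^ k := by
    refine Asymptotics.IsBigO.of_bound (1 / (r - 1)) (Eventually.of_forall fun k => ?_)
    have : 1 ≤ r ^ k := one_le_pow₀ hr.le
    rw [hgeom, Real.norm_of_nonneg (div_nonneg (by linarith) (by linarith)),
      Real.norm_of_nonneg (by positivity), one_div, inv_mul_eq_div]
    gcongr
    · linarith
  have h4 := (h2.trans_isBigO h3).tendsto_div_nhds_zero
  have h5 : Tendsto (fun k => c / (r - 1) * (1 - (r ^ k)⁻¹)) atTop (𝓝 (c / (r - 1))) := by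
    simpa using (hpow.inv_tendsto_atTop.const_sub 1).const_mul (c / (r - 1))
  have h6 := h4.add h5
  rw [zero_add] at h6
  refine h6.congr fun k => ?_
  have hr1 : r - 1 ≠ 0 := by linarith
  rw [Finset.sum_sub_distrib, ← Finset.mul_sum, hgeom]
  field_simp
  ring

/-- The limit defining the curvature exists, and the curvature is the limit of the normalized
traces of `P` on the words of length `m`. -/
theorem IsDeterminingProjection.tendsto_normTrace (h : IsDeterminingProjection A α P)
    (hn : 2 ≤ n) :
    Tendsto (normTrace A) atTop
      (𝓝 (ENNReal.ofReal ((⨅ m, levelMass P m / (n : ℝ) ^ m) / (n - 1)))) := by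
  have hn1 : (1 : ℝ) < n := by exact_mod_cast (by omega : 1 < n)
  have h1 := tendsto_geom_cesaro hn1 (tendsto_atTop_ciInf (h.antitone_level hn)
    ⟨0, by rintro _ ⟨m, rfl⟩; exact div_nonneg (levelMass_nonneg P m) (by positivity)⟩)
  refine (ENNReal.tendsto_ofReal h1).congr fun k => ?_
  rw [normTrace, h.posTrace_one_sub_cpPow, ENNReal.ofReal_div_of_pos (by positivity),
    ENNReal.ofReal_pow (by positivity), ENNReal.ofReal_natCast]

theorem IsDeterminingProjection.curvature_eq (h : IsDeterminingProjection A α P) (hn : 2 ≤ n) :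
    curvature A = ENNReal.ofReal (⨅ m, levelMass P m / (n : ℝ) ^ m) := by
  have hn1 : (0 : ℝ) < n - 1 := by
    have : (1 : ℝ) < n := by exact_mod_cast (by omega : 1 < n)
    linarith
  -- The truncated difference n - 1 in [0, ∞] is the real n - 1, which cancels the Cesàro factor 1 /
  -- (n - 1).
  rw [curvature, (h.tendsto_normTrace hn).limUnder_eq, ← ENNReal.ofReal_natCast,
    ← ENNReal.ofReal_one, ← ENNReal.ofReal_sub _ zero_le_one, ← ENNReal.ofReal_mul hn1.le,
    mul_div_cancel₀ _ hn1.ne']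

/-- For a projection ‖Pξ‖² = ⟪ξ, Pξ⟫, so weak convergence suffices. -/
theorem tendsto_levelMass {P : FockSum n α →L[ℂ] FockSum n α}
    {Pl : ℕ → FockSum n α →L[ℂ] FockSum n α} (hP : IsStarProjection P)
    (hPl : ∀ l, IsStarProjection (Pl l))
    (hlim : Tendsto (fun l => ContinuousLinearMapWOT.ofCLM (Pl l)) atTop
      (𝓝 (ContinuousLinearMapWOT.ofCLM P))) (m : ℕ) :
    Tendsto (fun l => levelMass (Pl l) m) atTop (𝓝 (levelMass P m)) := by
  rw [ContinuousLinearMapWOT.tendsto_iff_forall_inner_apply_tendsto] at hlim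
  refine tendsto_finsetSum _ fun w _ => tendsto_finsetSum _ fun j _ => ?_
  simp only [star_projection_norm_sq hP, fun l => star_projection_norm_sq (hPl l)]
  exact (RCLike.continuous_re.tendsto _).comp (hlim (xiSum j w) (xiSum j w))

theorem limsup_curvature_le (hn : 2 ≤ n) {F : ℕ → Type*} [∀ l, NormedAddCommGroup (F l)]
    [∀ l, InnerProductSpace ℂ (F l)] [∀ l, CompleteSpace (F l)]
    {Al : ∀ l, Fin n → F l →L[ℂ] F l} {Pl : ℕ → FockSum n α →L[ℂ] FockSum n α}
    (h : IsDeterminingProjection A α P) (hl : ∀ l, IsDeterminingProjection (Al l) α (Pl l))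
    (hlim : Tendsto (fun l => ContinuousLinearMapWOT.ofCLM (Pl l)) atTop
      (𝓝 (ContinuousLinearMapWOT.ofCLM P))) :
    limsup (fun l => curvature (Al l)) atTop ≤ curvature A := by
  have hbdd : ∀ Q : FockSum n α →L[ℂ] FockSum n α,
      BddBelow (Set.range fun m => levelMass Q m / (n : ℝ) ^ m) := fun Q =>
    ⟨0, by rintro _ ⟨m, rfl⟩; exact div_nonneg (levelMass_nonneg Q m) (by positivity)⟩
  rw [h.curvature_eq hn]
  -- For fixed m, K(A_l) ≤ t_m(P_l) / n^m, which tends to t_m(P) / n^m as l → ∞; only then does m →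
  -- ∞.
  refine ge_of_tendsto' (ENNReal.tendsto_ofReal
    (tendsto_atTop_ciInf (h.antitone_level hn) (hbdd P))) fun m => ?_
  rw [← (ENNReal.tendsto_ofReal
    ((tendsto_levelMass h.1 (fun l => (hl l).1) hlim m).div_const _)).limsup_eq]
  refine limsup_le_limsup (Eventually.of_forall fun l => ?_)
  simp only [(hl l).curvature_eq hn]
  exact ENNReal.ofReal_le_ofReal (ciInf_le (hbdd (Pl l)) m)

end Curvature

/-! ### The Poisson isometry -/

section Poisson

variable {n α : ℕ} {E : Type*} [NormedAddCommGroup E] [InnerProductSpace ℂ E] [CompleteSpace E]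

theorem IsMinimalIsometricDilation.adjoint_apply {K : Type*} [NormedAddCommGroup K]
    [InnerProductSpace ℂ K] [CompleteSpace K] {A : Fin n → E →L[ℂ] E} {V : E →ₗᵢ[ℂ] K}
    {S : Fin n → K →L[ℂ] K} (h : IsMinimalIsometricDilation A V S) (i : Fin n) (x : E) :
    adjoint (S i) (V x) = V (adjoint (A i) x) := by
  obtain ⟨z, hz⟩ := h.coinvariant i x
  rw [← hz]
  congr 1
  refine ext_inner_left ℂ fun y => ?_
  rw [ContinuousLinearMap.adjoint_inner_right, ← h.compression,
    ContinuousLinearMap.adjoint_inner_left, ← V.inner_map_map, hz,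
    ContinuousLinearMap.adjoint_inner_right]
  rfl

/-- Qy is orthogonal to the range of every S_j, hence ‖Qy‖² = ⟪y, Qy⟫. -/
theorem norm_sq_one_sub_sum {K : Type*} [NormedAddCommGroup K] [InnerProductSpace ℂ K]
    [CompleteSpace K] {S : Fin n → K →L[ℂ] K}
    (hS : ∀ i j, adjoint (S i) ∘L S j = if i = j then 1 else 0) (y : K) :
    ‖(1 - ∑ i, S i ∘L adjoint (S i)) y‖ ^ 2 = ‖y‖ ^ 2 - ∑ i, ‖adjoint (S i) y‖ ^ 2 := by
  set Q := 1 - ∑ i, S i ∘L adjoint (S i) with hQ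
  have hQy : Q y = y - ∑ i, S i (adjoint (S i) y) := by simp [hQ]
  have hSS : ∀ i j z, adjoint (S i) (S j z) = if i = j then z else 0 := fun i j z => by
    have := DFunLike.congr_fun (hS i j) z
    rw [ContinuousLinearMap.comp_apply] at this
    rw [this]
    split_ifs <;> rfl
  have hSQ : ∀ j, adjoint (S j) (Q y) = 0 := fun j => by
    rw [hQy, map_sub, map_sum]
    simp [hSS]
  have h1 : ⟪y - ∑ i, S i (adjoint (S i) y), Q y⟫_ℂ = ⟪y, Q y⟫_ℂ := by
    rw [inner_sub_left, sum_inner]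
    simp only [← ContinuousLinearMap.adjoint_inner_right, hSQ, inner_zero_right,
      Finset.sum_const_zero, sub_zero]
  have h2 : ⟪y, Q y⟫_ℂ = ⟪y, y⟫_ℂ - ∑ i, ⟪adjoint (S i) y, adjoint (S i) y⟫_ℂ := by
    rw [hQy, inner_sub_right, inner_sum]
    simp only [ContinuousLinearMap.adjoint_inner_left]
  rw [← hQy] at h1
  have h3 : ∀ z : K, ‖z‖ ^ 2 = RCLike.re ⟪z, z⟫_ℂ := fun z => (inner_self_eq_norm_sq z).symm
  simp only [h3]
  rw [h1, h2, map_sub, map_sum]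

/-- An operator of rank at most `α` has the norm of a map into `ℂ^α`. -/
theorem exists_functionals_of_opRank_le {K : Type*} [NormedAddCommGroup K] [InnerProductSpace ℂ K]
    (Q : K →L[ℂ] K) (hQ : opRank Q ≤ α) :
    ∃ φ : Fin α → K →L[ℂ] ℂ, ∀ y, ∑ j, ‖φ j y‖ ^ 2 = ‖Q y‖ ^ 2 := by
  let N : Submodule ℂ K := LinearMap.range (Q : K →ₗ[ℂ] K)
  have hrank : Module.rank ℂ N ≤ α := by
    rw [opRank] at hQ
    simpa using hQ
  have : FiniteDimensional ℂ N :=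
    Module.rank_lt_aleph0_iff.1 (hrank.trans_lt (Cardinal.natCast_lt_aleph0))
  have hd : Module.finrank ℂ N ≤ α := Module.finrank_le_of_rank_le hrank
  let e := stdOrthonormalBasis ℂ N
  -- Coordinates of Qy in an orthonormal basis of the range, padded by zero functionals up to α.
  refine ⟨fun j => if h : (j : ℕ) < Module.finrank ℂ N then innerSL ℂ (e ⟨j, h⟩ : K) ∘L Q else 0,
    fun y => ?_⟩
  have h1 := e.sum_sq_norm_inner_right (⟨Q y, y, rfl⟩ : N)
  refine Eq.trans (Eq.symm ?_) h1
  refine Fintype.sum_of_injective (Fin.castLE hd) (Fin.castLE_injective hd) _ _ ?_ ?_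
  · intro j hj
    have : ¬ (j : ℕ) < Module.finrank ℂ N := fun h => hj ⟨⟨j, h⟩, rfl⟩
    simp [this]
  · intro j
    simp

/-- The infimum of the empty set is ⊤, so a finite bound on `pureRank` itself supplies a minimal
dilation attaining it. -/
theorem exists_mem_le_of_sInf_le {s : Set ℕ∞} (h : sInf s ≤ α) : ∃ r ∈ s, r ≤ α := by
  refine ⟨sInf s, csInf_mem (Set.nonempty_iff_ne_empty.2 fun hs => ?_), h⟩
  rw [hs, sInf_empty, top_le_iff] at h
  exact ENat.natCast_ne_top α h

/-- A tuple of pure rank at most `α` has a defect operator which factors through `ℂ^α`. -/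
theorem exists_functionals_of_pureRank_le {H : Type u} [NormedAddCommGroup H]
    [InnerProductSpace ℂ H] [CompleteSpace H] {A : Fin n → H →L[ℂ] H} (hr : pureRank A ≤ α) :
    ∃ β : Fin α → H →L[ℂ] ℂ, ∀ x,
      ∑ j, ‖β j x‖ ^ 2 = ‖x‖ ^ 2 - ∑ i, ‖adjoint (A i) x‖ ^ 2 := by
  obtain ⟨_, ⟨K, _, _, _, V, S, hS, rfl⟩, hrank⟩ := exists_mem_le_of_sInf_le hr
  obtain ⟨φ, hφ⟩ := exists_functionals_of_opRank_le _ hrank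
  refine ⟨fun j => φ j ∘L V.toContinuousLinearMap, fun x => ?_⟩
  refine (hφ (V x)).trans ?_
  rw [norm_sq_one_sub_sum hS.isometry]
  simp only [hS.adjoint_apply, V.norm_map]

/-- An isometry into Fock space which intertwines the adjoints gives a determining projection. -/
theorem isDeterminingProjection_of_intertwiner {A : Fin n → E →L[ℂ] E} (U : E →ₗᵢ[ℂ] FockSum n α)
    (hU : ∀ i x, U (adjoint (A i) x) = adjoint (leftCreationSum α i) (U x)) :
    IsDeterminingProjection A α
      (U.toContinuousLinearMap ∘L adjoint U.toContinuousLinearMap) := by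
  have hUU : ∀ x, adjoint U.toContinuousLinearMap (U x) = x := fun x => by
    refine ext_inner_left ℂ fun y => ?_
    rw [ContinuousLinearMap.adjoint_inner_right]
    exact U.inner_map_map y x
  have hrange : Set.range U =
      Set.range (U.toContinuousLinearMap ∘L adjoint U.toContinuousLinearMap) := by
    ext f
    constructor
    · rintro ⟨x, rfl⟩
      exact ⟨U x, congrArg U (hUU x)⟩
    · rintro ⟨g, rfl⟩
      exact ⟨_, rfl⟩
  refine ⟨⟨?_, ?_⟩, ?_, U, hrange, fun i x => ?_⟩
  · ext1 f
    exact congrArg U (hUU _)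
  · rw [ContinuousLinearMap.isSelfAdjoint_iff', ContinuousLinearMap.adjoint_comp,
      ContinuousLinearMap.adjoint_adjoint]
  · rw [← hrange]
    rintro i _ ⟨x, rfl⟩
    exact ⟨_, hU i x⟩
  · refine congrArg U (ext_inner_left ℂ fun y => ?_)
    refine Eq.trans ?_ (ContinuousLinearMap.adjoint_inner_right _ _ _).symm
    rw [← ContinuousLinearMap.adjoint_inner_left, ← U.inner_map_map, hU,
      ContinuousLinearMap.adjoint_inner_left]
    rfl

/-- The partial sums over balls are ⟪x, (I - Φ_A^k(I)) x⟫, which tend to ‖x‖² by purity; positivity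
of the terms upgrades this to unconditional summation. -/
theorem hasSum_poisson {A : Fin n → E →L[ℂ] E} (hA : IsPureContraction A)
    {β : Fin α → E →L[ℂ] ℂ}
    (hβ : ∀ x, ∑ j, ‖β j x‖ ^ 2 = ‖x‖ ^ 2 - ∑ i, ‖adjoint (A i) x‖ ^ 2) (x : E) :
    HasSum (fun w => ∑ j, ‖β j (adjoint (FreeMonoid.lift A w) x)‖ ^ 2) (‖x‖ ^ 2) := by
  have hlim : Tendsto
      (fun k => ∑ w ∈ ball n k, ∑ j, ‖β j (adjoint (FreeMonoid.lift A w) x)‖ ^ 2) atTop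
      (𝓝 (‖x‖ ^ 2)) := by
    simp only [hβ, ← re_inner_one_sub_cpPow]
    have h1 : Tendsto (fun k => (1 - cpPow A k) x) atTop (𝓝 (x - 0)) :=
      (hA.2 x).const_sub x
    have h2 := (RCLike.continuous_re (K := ℂ)).tendsto _ |>.comp
      ((tendsto_const_nhds (x := x)).inner (𝕜 := ℂ) h1)
    rw [sub_zero, inner_self_eq_norm_sq] at h2
    exact h2
  have hnn : ∀ w, 0 ≤ ∑ j, ‖β j (adjoint (FreeMonoid.lift A w) x)‖ ^ 2 :=
    fun w => Finset.sum_nonneg fun _ _ => sq_nonneg _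
  have hmono : Monotone
      fun s : Finset _ => ∑ w ∈ s, ∑ j, ‖β j (adjoint (FreeMonoid.lift A w) x)‖ ^ 2 :=
    fun s t hst => Finset.sum_le_sum_of_subset_of_nonneg hst fun w _ _ => hnn w
  exact (tendsto_iff_tendsto_subseq_of_monotone hmono (tendsto_ball n)).2 hlim

/-- The Poisson isometry of a pure contraction whose defect operator factors through `ℂ^α`. -/
theorem exists_poisson {A : Fin n → E →L[ℂ] E} (hA : IsPureContraction A)
    {β : Fin α → E →L[ℂ] ℂ}
    (hβ : ∀ x, ∑ j, ‖β j x‖ ^ 2 = ‖x‖ ^ 2 - ∑ i, ‖adjoint (A i) x‖ ^ 2) :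
    ∃ U : E →ₗᵢ[ℂ] FockSum n α,
      ∀ i x, U (adjoint (A i) x) = adjoint (leftCreationSum α i) (U x) := by
  have hsum : ∀ x j, Summable fun w => ‖β j (adjoint (FreeMonoid.lift A w) x)‖ ^ 2 :=
    fun x j => (hasSum_poisson hA hβ x).summable.of_nonneg_of_le (fun _ => sq_nonneg _)
      fun w => Finset.single_le_sum
        (f := fun j => ‖β j (adjoint (FreeMonoid.lift A w) x)‖ ^ 2)
        (fun _ _ => sq_nonneg _) (Finset.mem_univ j)
  have hmem : ∀ x j, Memℓp (fun w => β j (adjoint (FreeMonoid.lift A w) x)) 2 :=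
    fun x j => memℓp_gen (by simpa using hsum x j)
  let T : E →ₗ[ℂ] FockSum n α :=
    { toFun := fun x => WithLp.toLp 2 fun j => ⟨_, hmem x j⟩
      map_add' := fun x y => by
        refine PiLp.ext fun j => lp.ext (funext fun w => ?_)
        exact ((congrArg (β j) (map_add _ x y)).trans (map_add (β j) _ _))
      map_smul' := fun c x => by
        refine PiLp.ext fun j => lp.ext (funext fun w => ?_)
        exact ((congrArg (β j) (map_smul _ c x)).trans (map_smul (β j) _ _)) }
  have hT : ∀ x j w, T x j w = β j (adjoint (FreeMonoid.lift A w) x) := fun _ _ _ => rfl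
  refine ⟨⟨T, fun x => ?_⟩, fun i x => PiLp.ext fun j => lp.ext (funext fun w => ?_)⟩
  · rw [← sq_eq_sq₀ (norm_nonneg _) (norm_nonneg _), PiLp.norm_sq_eq_of_L2]
    refine HasSum.unique (f := fun w => ∑ j, ‖T x j w‖ ^ 2) ?_ (hasSum_poisson hA hβ x)
    exact hasSum_sum fun j _ => hasSum_norm_sq (T x j)
  -- Both sides have coordinate β_j(A_{iw}^* x) at w.
  · rw [adjoint_leftCreationSum_apply, adjoint_leftCreation_apply]
    exact congrArg (β j) (adjoint_lift_of_mul A i w x).symm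

/-- A pure contraction of pure rank at most `α` is the compression of `L^{(α)}` to a co-invariant
subspace. -/
theorem exists_isDeterminingProjection {H : Type u} [NormedAddCommGroup H]
    [InnerProductSpace ℂ H] [CompleteSpace H] {A : Fin n → H →L[ℂ] H} (hA : IsPureContraction A)
    (hr : pureRank A ≤ α) : ∃ P, IsDeterminingProjection A α P := by
  obtain ⟨β, hβ⟩ := exists_functionals_of_pureRank_le hr
  obtain ⟨U, hU⟩ := exists_poisson hA hβ
  exact ⟨_, isDeterminingProjection_of_intertwiner U hU⟩

end Poisson

end RowContraction

end

theorem mainTheorem6 {n : ℕ} (hn : 2 ≤ n) (α : ℕ)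
    {H : Type u} [NormedAddCommGroup H] [InnerProductSpace ℂ H] [CompleteSpace H]
    {Hl : ℕ → Type v} [∀ l, NormedAddCommGroup (Hl l)] [∀ l, InnerProductSpace ℂ (Hl l)]
    [∀ l, CompleteSpace (Hl l)]
    (A : Fin n → H →L[ℂ] H) (Al : ∀ l, Fin n → Hl l →L[ℂ] Hl l)
    (hA : IsPureContraction A) (hAl : ∀ l, IsPureContraction (Al l))
    (hr : pureRank A ≤ α) (hrl : ∀ l, pureRank (Al l) ≤ α) :
    -- every such tuple is a compression of `L^{(α)}` to a co-invariant subspace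
    (∃ P, IsDeterminingProjection A α P) ∧
    (∀ l, ∃ P, IsDeterminingProjection (Al l) α P) ∧
    -- the limits defining the curvature invariants exist
    (∃ c, Tendsto (normTrace A) atTop (𝓝 c)) ∧
    (∀ l, ∃ c, Tendsto (normTrace (Al l)) atTop (𝓝 c)) ∧
    -- upper semi-continuity
    ∀ (P : FockSum n α →L[ℂ] FockSum n α) (Pl : ℕ → FockSum n α →L[ℂ] FockSum n α),
      IsDeterminingProjection A α P →
      (∀ l, IsDeterminingProjection (Al l) α (Pl l)) →
      Tendsto (fun l => ContinuousLinearMapWOT.ofCLM (Pl l)) atTop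
        (𝓝 (ContinuousLinearMapWOT.ofCLM P)) →
      limsup (fun l => curvature (Al l)) atTop ≤ curvature A := by
  have hex := exists_isDeterminingProjection hA hr
  have hexl := fun l => exists_isDeterminingProjection (hAl l) (hrl l)
  refine ⟨hex, hexl, ?_, fun l => ?_, fun P Pl hP hPl hlim => limsup_curvature_le hn hP hPl hlim⟩
  · obtain ⟨P, hP⟩ := hex
    exact ⟨_, hP.tendsto_normTrace hn⟩
  · obtain ⟨P, hP⟩ := hexl l
    exact ⟨_, hP.tendsto_normTrace hn⟩
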